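/- Let $\mathcal{R}$ (red points) and $\mathcal{B}$ (blue points) be independent homogeneous Poisson processes on $\mathbb{R}$ with the same finite intensity $\lambda_{\mathcal R}=\lambda_{\mathcal B}$. Let $\mathcal{M}$ be the two-color stable multi-matching of $\mathcal{R}$ and $\mathcal{B}$ with constant degree $2$. That is, $\mathcal{M}$ is a translation-invariant (in law) point process of edges such that almost surely: every edge joins a red point and a blue point, there are no multiple edges, every red point and every blue point has exactly two incident edges, and for any red point $x$ and any blue point $y$, either $x$ and $y$ are linked by an edge, or at least one of $x,y$ has no incident edge longer than $|x-y|$. For a red or blue point $x$, let $M_x$ be the length of the longest edge incident to $x$, and say that $x$ desires a location $y\in\mathbb{R}$ if $|x-y|<M_x$. Let $N$ be the number of blue points that desire the origin. If almost surely the graph with vertex set the red and blue points and edge set $\mathcal{M}$ has an infinite connected component, then $N<\infty$ almost surely. -/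

import Mathlib

open MeasureTheory ProbabilityTheory
open scoped NNReal ENNReal

namespace TwoColor

/-- The support (point set) `[m] = {x : m {x} > 0}` of a measure. -/
def pts {E : Type*} [MeasurableSpace E] (m : Measure E) : Set E :=
  {x | 0 < m {x}}

/-- A point process: a random measure which almost surely takes a finite integer value on every
bounded Borel set. -/
structure IsPointProcess {Ω E : Type*} [MeasurableSpace Ω] [MeasurableSpace E] [Bornology E]
    (P : Measure Ω) (L : Ω → Measure E) : Prop where
  measurable : Measurable L
  integerValued : ∀ᵐ ω ∂P, ∀ A : Set E, MeasurableSet A → Bornology.IsBounded A →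
    ∃ n : ℕ, L ω A = n

/-- A homogeneous Poisson process on the line with intensity `lam`: the number of points in a
bounded Borel set is Poisson distributed with mean `lam` times its length, and the numbers of
points in disjoint bounded Borel sets are independent. -/
structure IsPoissonProcess {Ω : Type*} [MeasurableSpace Ω] (P : Measure Ω)
    (L : Ω → Measure ℝ) (lam : ℝ≥0) : Prop extends IsPointProcess P L where
  law : ∀ A : Set ℝ, MeasurableSet A → Bornology.IsBounded A →
    P.map (fun ω => L ω A) =
      (poissonMeasure (lam * (volume A).toNNReal)).map (fun n : ℕ => (n : ℝ≥0∞))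
  indep : ∀ (n : ℕ) (A : Fin n → Set ℝ), (∀ i, MeasurableSet (A i)) →
    (∀ i, Bornology.IsBounded (A i)) → (∀ i j, i ≠ j → Disjoint (A i) (A j)) →
    iIndepFun (fun i ω => L ω (A i)) P

/-- The graph whose edges are the points of an edge configuration `m`. Every edge joins a red
point and a blue point, and is recorded as the pair (red end, blue end). Real numbers that are
not ends of any edge are isolated in this graph. -/
def graph (m : Measure (ℝ × ℝ)) : SimpleGraph ℝ :=
  SimpleGraph.fromRel (fun x y => (x, y) ∈ pts m)

/-- The length `M_x` of the longest edge incident to `x`. -/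
noncomputable def longest (m : Measure (ℝ × ℝ)) (x : ℝ) : ℝ≥0∞ :=
  ⨆ z ∈ (graph m).neighborSet x, edist x z

/-- The point `x` desires the location `y` if `|x - y| < M_x`. -/
def Desires (m : Measure (ℝ × ℝ)) (x y : ℝ) : Prop :=
  edist x y < longest m x

/-- Some connected component of the graph contains infinitely many points. -/
def HasInfiniteComponent (m : Measure (ℝ × ℝ)) : Prop :=
  ∃ c : (graph m).ConnectedComponent, c.supp.Infinite

/-- The number of points of the blue configuration `b` that desire the origin. -/
noncomputable def numDesireOrigin (b : Measure ℝ) (m : Measure (ℝ × ℝ)) : ℕ∞ :=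
  {y | y ∈ pts b ∧ Desires m y 0}.encard

/-- A simple, translation-invariant two-color multi-matching scheme for the red process `R` and
the blue process `B`, in which every red point has degree `dR` and every blue point has degree
`dB`. -/
structure IsMultiMatchingScheme {Ω : Type*} [MeasurableSpace Ω] (P : Measure Ω)
    (R B : Ω → Measure ℝ) (dR dB : ℕ) (M : Ω → Measure (ℝ × ℝ)) : Prop
    extends IsPointProcess P M where
  bipartite : ∀ᵐ ω ∂P, ∀ p ∈ pts (M ω), p.1 ∈ pts (R ω) ∧ p.2 ∈ pts (B ω)
  simple : ∀ᵐ ω ∂P, ∀ p ∈ pts (M ω), M ω {p} = 1 ∧ p.1 ≠ p.2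
  degree_red : ∀ᵐ ω ∂P, ∀ x ∈ pts (R ω), ((graph (M ω)).neighborSet x).encard = dR
  degree_blue : ∀ᵐ ω ∂P, ∀ y ∈ pts (B ω), ((graph (M ω)).neighborSet y).encard = dB
  invariant : ∀ t : ℝ,
    P.map (fun ω => (M ω).map (fun p : ℝ × ℝ => (p.1 + t, p.2 + t))) = P.map M

/-- A two-color multi-matching scheme is stable if almost surely, for any red point `x` and any
blue point `y` (distinct), either they are linked by an edge, or at least one of them has no
incident edge longer than `|x - y|`. -/
structure IsStableMultiMatching {Ω : Type*} [MeasurableSpace Ω] (P : Measure Ω)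
    (R B : Ω → Measure ℝ) (dR dB : ℕ) (M : Ω → Measure (ℝ × ℝ)) : Prop
    extends IsMultiMatchingScheme P R B dR dB M where
  stable : ∀ᵐ ω ∂P, ∀ x ∈ pts (R ω), ∀ y ∈ pts (B ω), x ≠ y →
    (graph (M ω)).Adj x y ∨ longest (M ω) x ≤ edist x y ∨ longest (M ω) y ≤ edist x y

end TwoColor

/-!
Only the deterministic consequences of stability, local finiteness and stationarity matter.

Two edges that cross (neither of the two intervals containing the other) are joined by a third
edge, since otherwise some red end of one and some blue end of the other would be an unstable pair
(`StableConfig.adj_of_interlaced`). Hence the points enclosed by an edge `p q` are separated from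
the others by `p`, `q` and their neighbors. All degrees are two, so if edges enclosed arbitrarily
large intervals, then a component containing a given point could leave such an edge only at the two
ends of a path of four vertices, and parity of the number of odd degrees forces the component to be
finite (`finite_reachable_of_path_exit`). Thus an infinite component excludes edges straddling
arbitrarily large intervals (`StableConfig.exists_not_straddled`), and every edge lies in a maximal
one.

On the other hand, stability and the degree bound allow at most two maximal edges of each color
orientation above a given location (`StableConfig.not_staircase`). By stationarity, the
probabilities that a maximal edge starting in a fixed unit interval has length at least `n` are
therefore summable, and the Borel-Cantelli lemma shows that far from the origin no maximal edge is
longer than its distance to the origin (`ae_eventually_not_newReach`). A point desiring the origin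
has an edge longer than its distance to the origin, and its position is bounded by
`StableConfig.exists_bound_desires`; reflection handles the negative half-line.
-/

namespace TwoColor

open Set Filter Topology

/-! ### Components of graphs with all degrees two -/

theorem finite_reachable_of_closed {V : Type*} {G : SimpleGraph V} {T : Set V} {v : V}
    (hT : T.Finite) (hv : v ∈ T) (hcl : ∀ u ∈ T, G.neighborSet u ⊆ T) :
    {w | G.Reachable v w}.Finite := by
  refine hT.subset ?_
  rintro w ⟨c⟩
  induction c with
  | nil => exact hv
  | cons h _ ih => exact ih (hcl _ hv h)

theorem degree_induce_eq_ncard {V : Type*} (G : SimpleGraph V) (T : Set V) (x : T)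
    [Fintype ((G.induce T).neighborSet x)] :
    (G.induce T).degree x = (G.neighborSet x ∩ T).ncard := by
  rw [← SimpleGraph.card_neighborFinset_eq_degree, ← Set.ncard_coe_finset,
    SimpleGraph.coe_neighborFinset, ← Set.ncard_image_of_injective _ Subtype.val_injective]
  congr 1
  ext w
  simp only [mem_image, SimpleGraph.mem_neighborSet, SimpleGraph.comap_adj, mem_inter_iff,
    Function.Embedding.subtype_apply, Subtype.exists, exists_and_right, exists_eq_right]
  exact ⟨fun ⟨a, b⟩ => ⟨b, a⟩, fun ⟨a, b⟩ => ⟨b, a⟩⟩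

/-- Suppose all degrees are two and `U` is a finite set of vertices which can only be left through
the two ends `p'`, `q'` of a path `p' - p - q - q'`. Then the component of any vertex of `U` is
finite. By the handshake lemma in the subgraph induced by `U` and the path, `p'` and `q'` either
both have a neighbor in `U`, which closes a cycle, or both have none, so that `U` is closed. -/
theorem finite_reachable_of_path_exit {V : Type*} {G : SimpleGraph V} {p q p' q' v : V} {U : Set V}
    (hU : U.Finite) (hv : v ∈ U) (hp : G.neighborSet p = {q, p'}) (hq : G.neighborSet q = {p, q'})
    (hpU : p ∉ U) (hqU : q ∉ U) (hpq' : p ≠ q') (hqp' : q ≠ p')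
    (hdegU : ∀ u ∈ U, (G.neighborSet u).ncard = 2)
    (hdegp : (G.neighborSet p').ncard = 2) (hdegq : (G.neighborSet q').ncard = 2)
    (hcl : ∀ u ∈ U, ∀ w, G.Adj u w → w ∈ U ∨ w = p' ∨ w = q') :
    {w | G.Reachable v w}.Finite := by
  classical
  set T : Set V := U ∪ {p, q, p', q'} with hTdef
  have hT : T.Finite := hU.union (by simp)
  have hpp' : G.Adj p p' := by
    rw [← SimpleGraph.mem_neighborSet, hp]; simp
  have hqq' : G.Adj q q' := by
    rw [← SimpleGraph.mem_neighborSet, hq]; simp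
  have hpq : G.Adj p q := by
    rw [← SimpleGraph.mem_neighborSet, hp]; simp
  have hUT : ∀ u ∈ U, G.neighborSet u ⊆ T := by
    intro u hu w hw
    rcases hcl u hu w hw with h | rfl | rfl <;> simp_all
  have hpT : G.neighborSet p ⊆ T := by rw [hp]; intro w; simp only [hTdef]; grind
  have hqT : G.neighborSet q ⊆ T := by rw [hq]; intro w; simp only [hTdef]; grind
  have : Finite T := hT
  have : Fintype T := Fintype.ofFinite T
  have hfull : ∀ x, (G.neighborSet x).ncard = 2 → G.neighborSet x ⊆ T →
      Even (G.neighborSet x ∩ T).ncard := by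
    intro x h1 h2
    rw [inter_eq_left.2 h2, h1]; exact even_two
  have hodd_imp : ∀ x : T, Odd ((G.induce T).degree x) →
      (x.1 = p' ∨ x.1 = q') ∧ ¬ G.neighborSet x.1 ⊆ T := by
    rintro ⟨x, hx⟩ h
    rw [degree_induce_eq_ncard, ← Nat.not_even_iff_odd] at h
    have hnp : (G.neighborSet p).ncard = 2 := by rw [hp]; exact Set.ncard_pair hqp'
    have hnq : (G.neighborSet q).ncard = 2 := by rw [hq]; exact Set.ncard_pair hpq'
    simp only [hTdef, mem_union, mem_insert_iff, mem_singleton_iff] at hx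
    rcases hx with hx | rfl | rfl | rfl | rfl
    · exact absurd (hfull x (hdegU x hx) (hUT x hx)) h
    · exact absurd (hfull _ hnp hpT) h
    · exact absurd (hfull _ hnq hqT) h
    · exact ⟨Or.inl rfl, fun h' => h (hfull _ hdegp h')⟩
    · exact ⟨Or.inr rfl, fun h' => h (hfull _ hdegq h')⟩
  -- A vertex with two neighbors, exactly one of which lies outside `T`.
  have hone : ∀ x y, (G.neighborSet x).ncard = 2 → G.Adj x y → y ∈ T → ¬ G.neighborSet x ⊆ T →
      G.neighborSet x ∩ T = {y} := by
    intro x y h2 hxy hyT hns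
    obtain ⟨a, b, hab, he⟩ := Set.ncard_eq_two.1 h2
    have hy : y ∈ G.neighborSet x := hxy
    rw [he] at hy hns ⊢
    ext w
    simp only [mem_inter_iff, mem_insert_iff, mem_singleton_iff] at *
    rcases hy with rfl | rfl
    · have : b ∉ T := fun hb => hns (by intro z hz; rcases hz with rfl | rfl <;> assumption)
      grind
    · have : a ∉ T := fun hb => hns (by intro z hz; rcases hz with rfl | rfl <;> assumption)
      grind
  have hpm : p ∈ T := by simp [hTdef]
  have hqm : q ∈ T := by simp [hTdef]
  have hp'm : p' ∈ T := by simp [hTdef]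
  have hq'm : q' ∈ T := by simp [hTdef]
  have hP : ¬ G.neighborSet p' ⊆ T → G.neighborSet p' ∩ T = {p} :=
    hone p' p hdegp hpp'.symm hpm
  have hQ : ¬ G.neighborSet q' ⊆ T → G.neighborSet q' ∩ T = {q} :=
    hone q' q hdegq hqq'.symm hqm
  have hPQ : ¬ G.neighborSet p' ⊆ T → ¬ G.neighborSet q' ⊆ T := by
    intro h
    obtain ⟨w, hw, hw'⟩ := (G.induce T).exists_ne_odd_degree_of_exists_odd_degree ⟨p', hp'm⟩
      (by rw [degree_induce_eq_ncard, hP h, ncard_singleton]; exact odd_one)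
    obtain ⟨h1 | h1, h2⟩ := hodd_imp w hw'
    · exact absurd (Subtype.ext h1) hw
    · rwa [h1] at h2
  have hQP : ¬ G.neighborSet q' ⊆ T → ¬ G.neighborSet p' ⊆ T := by
    intro h
    obtain ⟨w, hw, hw'⟩ := (G.induce T).exists_ne_odd_degree_of_exists_odd_degree ⟨q', hq'm⟩
      (by rw [degree_induce_eq_ncard, hQ h, ncard_singleton]; exact odd_one)
    obtain ⟨h1 | h1, h2⟩ := hodd_imp w hw'
    · rwa [h1] at h2
    · exact absurd (Subtype.ext h1) hw
  by_cases h : G.neighborSet p' ⊆ T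
  · have h' : G.neighborSet q' ⊆ T := by by_contra h'; exact hQP h' h
    refine finite_reachable_of_closed hT (Or.inl hv) ?_
    intro u hu
    simp only [hTdef, mem_union, mem_insert_iff, mem_singleton_iff] at hu
    rcases hu with hu | rfl | rfl | rfl | rfl
    · exact hUT u hu
    all_goals assumption
  · have hP := hP h
    have hQ := hQ (hPQ h)
    refine finite_reachable_of_closed hU hv ?_
    intro u hu w hw
    have huT : u ∈ T := Or.inl hu
    rcases hcl u hu w hw with h1 | rfl | rfl
    · exact h1
    · have : u ∈ G.neighborSet w ∩ T := ⟨SimpleGraph.Adj.symm hw, huT⟩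
      rw [hP] at this
      exact absurd (this ▸ hu) hpU
    · have : u ∈ G.neighborSet w ∩ T := ⟨SimpleGraph.Adj.symm hw, huT⟩
      rw [hQ] at this
      exact absurd (this ▸ hu) hqU

/-! ### Edge configurations of stable matchings -/

/-- The deterministic properties of a realization of a stable multi-matching with all degrees
equal to two. The red and blue points enter only as the ends of edges, a pair in `pts m` being
(red end, blue end); no disjointness of the two colors is required. -/
structure StableConfig (m : Measure (ℝ × ℝ)) : Prop where
  integerValued : ∀ A : Set (ℝ × ℝ), MeasurableSet A → Bornology.IsBounded A → ∃ n : ℕ, m A = n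
  ne : ∀ x y, (x, y) ∈ pts m → x ≠ y
  degree : ∀ x y, (graph m).Adj x y → ((graph m).neighborSet x).encard = 2
  locallyFinite : ∀ L : ℝ, {x | (∃ y, (graph m).Adj x y) ∧ |x| ≤ L}.Finite
  stable : ∀ r b r' b', (r, b') ∈ pts m → (r', b) ∈ pts m → r ≠ b → |r - b| < |r - b'| →
    |r - b| < |r' - b| → (graph m).Adj r b

theorem graph_adj (m : Measure (ℝ × ℝ)) (x y : ℝ) :
    (graph m).Adj x y ↔ x ≠ y ∧ ((x, y) ∈ pts m ∨ (y, x) ∈ pts m) :=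
  SimpleGraph.fromRel_adj _ _ _

theorem pts_map {E F : Type*} [MeasurableSpace E] [MeasurableSpace F] (e : E ≃ᵐ F) (m : Measure E)
    (p : F) : p ∈ pts (m.map e) ↔ e.symm p ∈ pts m := by
  have : e ⁻¹' {p} = {e.symm p} := by
    ext z; simp [MeasurableEquiv.eq_symm_apply]
  simp only [pts, mem_ofPred_eq, e.map_apply, this]

/-- The reflection `(x, y) ↦ (-x, -y)` of edges. -/
def negEdge : ℝ × ℝ ≃ᵐ ℝ × ℝ := (MeasurableEquiv.neg ℝ).prodCongr (MeasurableEquiv.neg ℝ)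

/-- The exchange of the two colors. -/
def swapEdge : ℝ × ℝ ≃ᵐ ℝ × ℝ := MeasurableEquiv.prodComm

@[simp] theorem mem_pts_map_negEdge (m : Measure (ℝ × ℝ)) (x y : ℝ) :
    (x, y) ∈ pts (m.map negEdge) ↔ (-x, -y) ∈ pts m :=
  pts_map negEdge m (x, y)

@[simp] theorem mem_pts_map_swapEdge (m : Measure (ℝ × ℝ)) (x y : ℝ) :
    (x, y) ∈ pts (m.map swapEdge) ↔ (y, x) ∈ pts m :=
  pts_map swapEdge m (x, y)

@[simp] theorem graph_map_negEdge_adj (m : Measure (ℝ × ℝ)) (x y : ℝ) :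
    (graph (m.map negEdge)).Adj x y ↔ (graph m).Adj (-x) (-y) := by
  simp [graph_adj]

@[simp] theorem graph_map_swapEdge (m : Measure (ℝ × ℝ)) : graph (m.map swapEdge) = graph m := by
  ext x y
  simp [graph_adj, or_comm]

theorem isBounded_preimage_negEdge {A : Set (ℝ × ℝ)} (hA : Bornology.IsBounded A) :
    Bornology.IsBounded (negEdge ⁻¹' A) := by
  have : negEdge ⁻¹' A = -A := rfl
  rw [this]; exact hA.neg

theorem isBounded_preimage_swapEdge {A : Set (ℝ × ℝ)} (hA : Bornology.IsBounded A) :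
    Bornology.IsBounded (swapEdge ⁻¹' A) := by
  have : swapEdge ⁻¹' A ⊆ (Prod.snd '' A) ×ˢ (Prod.fst '' A) := by
    rintro ⟨x, y⟩ h
    exact ⟨⟨(y, x), h, rfl⟩, ⟨(y, x), h, rfl⟩⟩
  exact (hA.image_snd.prod hA.image_fst).subset this

namespace StableConfig

variable {m : Measure (ℝ × ℝ)}

theorem map_negEdge (h : StableConfig m) : StableConfig (m.map negEdge) where
  integerValued A hA hb := by
    rw [negEdge.map_apply]
    exact h.integerValued _ (negEdge.measurable hA) (isBounded_preimage_negEdge hb)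
  ne x y hxy e := h.ne _ _ ((mem_pts_map_negEdge m x y).1 hxy) (by rw [e])
  degree x y hxy := by
    have : (graph (m.map negEdge)).neighborSet x = -(graph m).neighborSet (-x) := by
      ext w; simp
    rw [this, ← Set.image_neg_eq_neg, neg_injective.encard_image]
    exact h.degree _ _ ((graph_map_negEdge_adj m x y).1 hxy)
  locallyFinite L := by
    refine ((h.locallyFinite L).image Neg.neg).subset ?_
    rintro x ⟨⟨y, hy⟩, hx⟩
    exact ⟨-x, ⟨⟨-y, (graph_map_negEdge_adj m x y).1 hy⟩, by rwa [abs_neg]⟩, neg_neg x⟩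
  stable r b r' b' h1 h2 hne h3 h4 := by
    rw [mem_pts_map_negEdge] at h1 h2
    rw [graph_map_negEdge_adj]
    have e : ∀ a c : ℝ, |-a - -c| = |a - c| := fun a c => by rw [← abs_neg]; ring_nf
    exact h.stable _ _ _ _ h1 h2 (by simpa using hne) (by rwa [e, e]) (by rwa [e, e])

theorem map_swapEdge (h : StableConfig m) : StableConfig (m.map swapEdge) where
  integerValued A hA hb := by
    rw [swapEdge.map_apply]
    exact h.integerValued _ (swapEdge.measurable hA) (isBounded_preimage_swapEdge hb)
  ne x y hxy := (h.ne _ _ ((mem_pts_map_swapEdge m x y).1 hxy)).symm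
  degree x y hxy := by
    rw [graph_map_swapEdge] at *
    exact h.degree _ _ hxy
  locallyFinite L := by
    rw [graph_map_swapEdge]
    exact h.locallyFinite L
  stable r b r' b' h1 h2 hne h3 h4 := by
    rw [mem_pts_map_swapEdge] at h1 h2
    rw [graph_map_swapEdge]
    refine (h.stable b r b' r' h2 h1 hne.symm ?_ ?_).symm
    · rwa [abs_sub_comm b r, abs_sub_comm b r']
    · rwa [abs_sub_comm b r, abs_sub_comm b' r]

/-- A configuration charging a set has an edge in it. -/
theorem exists_mem_pts (h : StableConfig m) {A : Set (ℝ × ℝ)} (hA : 0 < m A) :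
    ∃ p ∈ A, p ∈ pts m := by
  by_contra! hno
  refine hA.ne' (measure_null_of_locally_null A fun p hp => ?_)
  have h0 : m {p} = 0 := by
    have := hno p hp
    simpa [pts] using this
  have hfin : ∀ r, m (Metric.closedBall p r) ≠ ⊤ := by
    intro r
    obtain ⟨n, hn⟩ := h.integerValued _ (Metric.isClosed_closedBall (x := p) (ε := r)).measurableSet
      Metric.isBounded_closedBall
    rw [hn]; exact ENNReal.natCast_ne_top n
  have hlim : Tendsto (fun n : ℕ => m (Metric.closedBall p (1 / ((n : ℝ) + 1)))) atTop (𝓝 0) := by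
    have := tendsto_measure_iInter_atTop (μ := m)
      (s := fun n : ℕ => Metric.closedBall p (1 / ((n : ℝ) + 1)))
      (fun n => Metric.isClosed_closedBall.measurableSet.nullMeasurableSet)
      (fun a b hab => Metric.closedBall_subset_closedBall (by gcongr)) ⟨0, hfin _⟩
    have hI : ⋂ n : ℕ, Metric.closedBall p (1 / ((n : ℝ) + 1)) = {p} := by
      ext z
      simp only [mem_iInter, Metric.mem_closedBall, mem_singleton_iff]
      refine ⟨fun hz => ?_, fun hz n => by rw [hz, dist_self]; positivity⟩
      have : dist z p ≤ 0 :=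
        le_of_tendsto_of_tendsto' tendsto_const_nhds tendsto_one_div_add_atTop_nhds_zero_nat hz
      exact dist_le_zero.1 this
    rw [hI, h0] at this
    exact this
  obtain ⟨n, hn⟩ := (hlim.eventually (gt_mem_nhds one_pos)).exists
  refine ⟨Metric.closedBall p (1 / ((n : ℝ) + 1)),
    mem_nhdsWithin_of_mem_nhds (Metric.closedBall_mem_nhds p (by positivity)), ?_⟩
  obtain ⟨k, hk⟩ := h.integerValued _
    (Metric.isClosed_closedBall (x := p) (ε := 1 / ((n : ℝ) + 1))).measurableSet
    Metric.isBounded_closedBall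
  rw [hk] at hn ⊢
  have : k < 1 := by exact_mod_cast hn
  simp [Nat.lt_one_iff.1 this]

/-- Of two crossing edges, an end of one is linked to an end of the other. A red end of one edge and
a blue end of the other are unstable unless linked as soon as they are closer to each other than
the ends of both edges. If `u` is red and `q` blue, or conversely, this applies to `u q`. Otherwise
it applies to `p u` if `u - p < w - u`, and to `q w` if not. -/
theorem adj_of_interlaced (h : StableConfig m) {p q u w : ℝ} (h1 : (graph m).Adj p q)
    (h2 : (graph m).Adj u w) (hpu : p < u) (huq : u < q) (hqw : q < w) :
    (graph m).Adj p u ∨ (graph m).Adj p w ∨ (graph m).Adj q u ∨ (graph m).Adj q w := by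
  have key := h.stable
  have a1 : |p - q| = q - p := by rw [abs_sub_comm, abs_of_pos]; linarith
  have a2 : |u - w| = w - u := by rw [abs_sub_comm, abs_of_pos]; linarith
  have a3 : |u - q| = q - u := by rw [abs_sub_comm, abs_of_pos]; linarith
  have a4 : |p - u| = u - p := by rw [abs_sub_comm, abs_of_pos]; linarith
  have a5 : |q - w| = w - q := by rw [abs_sub_comm, abs_of_pos]; linarith
  rw [graph_adj] at h1 h2
  rcases h1 with ⟨-, h1 | h1⟩ <;> rcases h2 with ⟨-, h2 | h2⟩
  · right; right; left
    exact (key u q p w h2 h1 huq.ne (by linarith) (by linarith)).symm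
  · rcases lt_or_ge (u - p) (w - u) with hc | hc
    · left
      exact key p u w q h1 h2 hpu.ne (by linarith) (by rw [abs_sub_comm w u]; linarith)
    · right; right; right
      refine (key w q p u h2 h1 hqw.ne' ?_ ?_).symm
      · rw [abs_sub_comm w q, abs_sub_comm w u]; linarith
      · rw [abs_sub_comm w q]; linarith
  · rcases lt_or_ge (u - p) (w - u) with hc | hc
    · left
      refine (key u p q w h2 h1 hpu.ne' ?_ ?_).symm
      · rw [abs_sub_comm u p]; linarith
      · rw [abs_sub_comm u p, abs_sub_comm q p]; linarith
    · right; right; right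
      refine key q w u p h1 h2 hqw.ne ?_ ?_
      · rw [abs_sub_comm q p]; linarith
      · linarith
  · right; right; left
    refine (key q u w p h1 h2 huq.ne' ?_ ?_)
    · rw [abs_sub_comm q u, abs_sub_comm q p]; linarith
    · rw [abs_sub_comm q u, abs_sub_comm w u]; linarith

end StableConfig

namespace StableConfig

variable {m : Measure (ℝ × ℝ)}

theorem exists_neighborSet_eq_pair (h : StableConfig m) {x y : ℝ} (hxy : (graph m).Adj x y) :
    ∃ z, y ≠ z ∧ (graph m).neighborSet x = {y, z} := by
  obtain ⟨a, b, hab, he⟩ := Set.encard_eq_two.1 (h.degree x y hxy)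
  have hy : y ∈ (graph m).neighborSet x := hxy
  rw [he] at hy ⊢
  rcases hy with rfl | rfl
  · exact ⟨b, hab, rfl⟩
  · exact ⟨a, hab.symm, Set.pair_comm _ _⟩

/-- If there is an infinite component then edges do not straddle arbitrarily large intervals.
For an edge `p q` straddling a point `v` of the component and its neighbors, the points reached
from `v` while avoiding `p`, `q` and their neighbors would stay in the interval `(p, q)`, and the
component of `v` would be finite. -/
theorem exists_not_straddled (h : StableConfig m) (hinf : HasInfiniteComponent m) :
    ∃ L : ℝ, ∀ x y, (graph m).Adj x y → x < -L → y ≤ L := by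
  obtain ⟨c, hc⟩ := hinf
  obtain ⟨v, rfl⟩ := c.exists_rep
  have hreach : ¬ {w | (graph m).Reachable v w}.Finite := by
    refine fun hf => hc (hf.subset fun w hw => ?_)
    exact (SimpleGraph.ConnectedComponent.exact hw).symm
  have hdeg : ∃ y, (graph m).Adj v y := by
    by_contra! hno
    refine hreach ((finite_singleton v).subset ?_)
    rintro w ⟨_ | ⟨h1, _⟩⟩
    · rfl
    · exact absurd h1 (hno _)
  obtain ⟨a, ha⟩ := hdeg
  obtain ⟨b, -, hN⟩ := h.exists_neighborSet_eq_pair ha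
  refine ⟨max |v| (max |a| |b|), ?_⟩
  by_contra! hno
  obtain ⟨p, q, hpq, hp, hq⟩ := hno
  have hv : ∀ x ∈ ({v, a, b} : Set ℝ), p < x ∧ x < q := by
    intro x hx
    have : |x| ≤ max |v| (max |a| |b|) := by
      rcases hx with rfl | rfl | rfl <;> simp
    have := abs_le.1 this
    constructor <;> linarith
  obtain ⟨p', hqp', hNp⟩ := h.exists_neighborSet_eq_pair hpq
  obtain ⟨q', hpq', hNq⟩ := h.exists_neighborSet_eq_pair hpq.symm
  have hadjp : ∀ w, (graph m).Adj p w ↔ w = q ∨ w = p' := fun w => by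
    rw [← SimpleGraph.mem_neighborSet, hNp]; rfl
  have hadjq : ∀ w, (graph m).Adj q w ↔ w = p ∨ w = q' := fun w => by
    rw [← SimpleGraph.mem_neighborSet, hNq]; rfl
  set X : Set ℝ := {p, q, p', q'} with hX
  have hvN : ∀ w, (graph m).Adj v w → p < w ∧ w < q := by
    intro w hw
    have : w ∈ (graph m).neighborSet v := hw
    rw [hN] at this
    exact hv w (Or.inr this)
  have hvX : v ∉ X := by
    rintro (rfl | rfl | rfl | rfl)
    · exact lt_irrefl _ (hv v (by simp)).1
    · exact lt_irrefl _ (hv v (by simp)).2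
    · exact lt_irrefl _ (hvN p ((hadjp v).2 (Or.inr rfl)).symm).1
    · exact lt_irrefl _ (hvN q ((hadjq v).2 (Or.inr rfl)).symm).2
  set U : Set ℝ := {u | Relation.ReflTransGen (fun a b => (graph m).Adj a b ∧ b ∉ X) v u} with hUdef
  have hU : ∀ u ∈ U, u ∉ X ∧ (p < u ∧ u < q) ∧ ∃ z, (graph m).Adj u z := by
    intro u hu
    induction hu with
    | refl => exact ⟨hvX, hv v (by simp), a, ha⟩
    | @tail u w _ huw ih =>
      obtain ⟨huX, ⟨h1, h2⟩, -⟩ := ih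
      obtain ⟨huw, hwX⟩ := huw
      refine ⟨hwX, ?_, u, huw.symm⟩
      have hnot : ∀ z, z ∉ X → ¬ (graph m).Adj p z ∧ ¬ (graph m).Adj q z := by
        intro z hz
        rw [hadjp, hadjq]
        simp only [hX, mem_insert_iff, mem_singleton_iff] at hz
        tauto
      have hwp : w ≠ p := by rintro rfl; exact hwX (by simp [hX])
      have hwq : w ≠ q := by rintro rfl; exact hwX (by simp [hX])
      have h3 := hnot u huX
      have h4 := hnot w hwX
      constructor
      · by_contra! hle
        rcases h.adj_of_interlaced huw.symm hpq (lt_of_le_of_ne hle hwp) h1 h2 with h5 | h5 | h5 | h5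
        · exact h4.1 h5.symm
        · exact h4.2 h5.symm
        · exact h3.1 h5.symm
        · exact h3.2 h5.symm
      · by_contra! hle
        rcases h.adj_of_interlaced hpq huw h1 h2 (lt_of_le_of_ne hle hwq.symm) with h5 | h5 | h5 | h5
        · exact h3.1 h5
        · exact h4.1 h5
        · exact h3.2 h5
        · exact h4.2 h5
  have hncard : ∀ x y, (graph m).Adj x y → ((graph m).neighborSet x).ncard = 2 := by
    intro x y hxy
    rw [Set.ncard_def, h.degree x y hxy]; rfl
  refine hreach (finite_reachable_of_path_exit (p := p) (q := q) (p' := p') (q' := q') (U := U)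
    ?_ Relation.ReflTransGen.refl hNp hNq ?_ ?_ hpq' hqp' ?_ ?_ ?_ ?_)
  · refine (h.locallyFinite (max |p| |q|)).subset fun u hu => ?_
    obtain ⟨-, ⟨h1, h2⟩, h3⟩ := hU u hu
    exact ⟨h3, abs_le_max_abs_abs h1.le h2.le⟩
  · exact fun hu => (hU p hu).1 (by simp [hX])
  · exact fun hu => (hU q hu).1 (by simp [hX])
  · intro u hu
    obtain ⟨-, -, z, hz⟩ := hU u hu
    exact hncard u z hz
  · exact hncard p' p ((hadjp p').2 (Or.inr rfl)).symm
  · exact hncard q' q ((hadjq q').2 (Or.inr rfl)).symm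
  · intro u hu w huw
    by_cases hw : w ∈ X
    · rcases hw with rfl | rfl | hw
      · rcases (hadjp u).1 huw.symm with rfl | rfl <;> exact absurd (by simp [hX]) (hU _ hu).1
      · rcases (hadjq u).1 huw.symm with rfl | rfl <;> exact absurd (by simp [hX]) (hU _ hu).1
      · exact Or.inr hw
    · exact Or.inl (Relation.ReflTransGen.tail hu ⟨huw, hw⟩)

theorem exists_reach_bound (h : StableConfig m) {L : ℝ}
    (hL : ∀ x y, (graph m).Adj x y → x < -L → y ≤ L) (c : ℝ) :
    ∃ K : ℝ, ∀ x y, (graph m).Adj x y → x ≤ c → y ≤ K := by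
  have hF := h.locallyFinite (max L |c|)
  have hF' := hF.biUnion (t := fun x => (graph m).neighborSet x) (by
    rintro x ⟨⟨y, hy⟩, -⟩
    exact Set.finite_of_encard_eq_coe (k := 2) (h.degree x y hy))
  obtain ⟨K, hK⟩ := hF'.bddAbove
  refine ⟨max K L, fun x y hxy hx => ?_⟩
  rcases lt_or_ge x (-L) with h1 | h1
  · exact (hL x y hxy h1).trans (le_max_right _ _)
  · refine (hK (mem_biUnion ⟨⟨y, hxy⟩, ?_⟩ hxy)).trans (le_max_left _ _)
    rw [abs_le]
    constructor
    · linarith [le_max_left L |c|]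
    · linarith [le_max_right L |c|, le_abs_self c]

/-- No three edges with red left ends form a staircase: the red point `p₃` would have to be linked
to all three right ends. -/
theorem not_staircase (h : StableConfig m) {p₁ p₂ p₃ q₁ q₂ q₃ : ℝ} (h₁ : (p₁, q₁) ∈ pts m)
    (h₂ : (p₂, q₂) ∈ pts m) (h₃ : (p₃, q₃) ∈ pts m) (hp₁ : p₁ < p₃) (hp₂ : p₂ < p₃) (hpq : p₃ < q₁)
    (hq₁ : q₁ < q₂) (hq₂ : q₂ < q₃) : False := by
  have a : ∀ x y : ℝ, x < y → |x - y| = y - x := fun x y hxy => by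
    rw [abs_sub_comm, abs_of_pos]; linarith
  have e₃ : (graph m).Adj p₃ q₃ := (graph_adj _ _ _).2 ⟨by linarith, Or.inl h₃⟩
  have e₁ : (graph m).Adj p₃ q₁ := by
    refine h.stable _ _ _ _ h₃ h₁ (by linarith) ?_ ?_ <;>
      rw [a _ _ (by linarith), a _ _ (by linarith)] <;> linarith
  have e₂ : (graph m).Adj p₃ q₂ := by
    refine h.stable _ _ _ _ h₃ h₂ (by linarith) ?_ ?_ <;>
      rw [a _ _ (by linarith), a _ _ (by linarith)] <;> linarith
  obtain ⟨z, -, hz⟩ := h.exists_neighborSet_eq_pair e₁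
  have hm : ∀ w, (graph m).Adj p₃ w → w = q₁ ∨ w = z := fun w hw => by
    have : w ∈ (graph m).neighborSet p₃ := hw
    rwa [hz] at this
  have h2 := hm _ e₂
  have h3 := hm _ e₃
  grind

end StableConfig

/-! ### Edges of long reach -/

/-- The edges with left end in `(-∞, a]` and right end in `(s, ∞)`, the left end being red. -/
def straddling (a s : ℤ) : Set (ℝ × ℝ) := Iic (a : ℝ) ×ˢ Ioi (s : ℝ)

theorem measurableSet_straddling (a s : ℤ) : MeasurableSet (straddling a s) :=
  measurableSet_Iic.prod measurableSet_Ioi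

/-- The configurations in which, for some integer `s ≥ c`, some edge (with red left end) starting
in `(k, k + 1]` reaches beyond `s`, and none starting further to the left does. Up to the
restriction to integers, this says that an edge which is maximal for inclusion among those with red
left end starts in `(k, k + 1]` and reaches beyond `c`; the present form makes measurability
immediate. -/
def newReach (k c : ℤ) : Set (Measure (ℝ × ℝ)) :=
  {m | ∃ s : ℤ, c ≤ s ∧ 0 < m (straddling (k + 1) s) ∧ m (straddling k s) = 0}

theorem measurableSet_newReach (k c : ℤ) : MeasurableSet (newReach k c) := by
  have : newReach k c = ⋃ s : ℤ, ⋃ _ : c ≤ s,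
      {m | 0 < m (straddling (k + 1) s)} ∩ {m | m (straddling k s) = 0} := by
    ext m
    simp only [newReach, mem_ofPred_eq, mem_iUnion, mem_inter_iff, exists_prop]
  rw [this]
  refine MeasurableSet.iUnion fun s => MeasurableSet.iUnion fun _ => ?_
  exact (measurableSet_lt measurable_const
      (Measure.measurable_coe (measurableSet_straddling _ _))).inter
    (Measure.measurable_coe (measurableSet_straddling _ _) (measurableSet_singleton 0))

namespace StableConfig

variable {m : Measure (ℝ × ℝ)}

/-- At most two maximal edges of the given type straddle the origin. -/
theorem card_le_two_of_newReach (h : StableConfig m) (F : Finset ℕ)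
    (hF : ∀ n ∈ F, m ∈ newReach (-(n + 1)) 0) : F.card ≤ 2 := by
  by_contra! hcard
  have hedge : ∀ n ∈ F, ∃ p q : ℝ, (p, q) ∈ pts m ∧ p ≤ -n ∧ 0 < q ∧
      ∀ j ∈ F, n < j → (-(j : ℝ) < p ∧ ∀ p' q', (p', q') ∈ pts m → p' ≤ -j → q' < q) := by
    intro n hn
    obtain ⟨s, hs, hpos, hzero⟩ := hF n hn
    obtain ⟨⟨p, q⟩, ⟨hp, hq⟩, hpq⟩ := h.exists_mem_pts hpos
    simp only [mem_Iic, mem_Ioi] at hp hq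
    have hs' : (0 : ℝ) ≤ s := by exact_mod_cast hs
    have hempty : ∀ p' q', (p', q') ∈ pts m → p' ≤ -((n : ℝ) + 1) → q' ≤ s := by
      intro p' q' h' hp'
      by_contra! hq'
      have : m {(p', q')} ≤ m (straddling (-(n + 1)) s) :=
        measure_mono (singleton_subset_iff.2 ⟨by simpa using hp', hq'⟩)
      rw [hzero] at this
      exact absurd this (not_le.2 h')
    refine ⟨p, q, hpq, by push_cast at hp; linarith, by linarith, fun j _ hj => ?_⟩
    have hj' : (n : ℝ) + 1 ≤ j := by exact_mod_cast hj
    refine ⟨?_, fun p' q' h' hp' => (hempty p' q' h' (by linarith)).trans_lt hq⟩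
    by_contra! hle
    exact absurd hq (not_lt.2 (hempty p q hpq (by linarith)))
  set e := F.orderEmbOfFin rfl with he
  have hmem : ∀ i, e i ∈ F := fun i => F.orderEmbOfFin_mem rfl i
  set i₀ : Fin F.card := ⟨0, by omega⟩
  set i₁ : Fin F.card := ⟨1, by omega⟩
  set i₂ : Fin F.card := ⟨2, by omega⟩
  have h01 : e i₀ < e i₁ := e.strictMono (by simp [i₀, i₁, Fin.lt_def])
  have h12 : e i₁ < e i₂ := e.strictMono (by simp [i₁, i₂, Fin.lt_def])
  obtain ⟨p₃, q₃, m₃, hp₃, hq₃, H₃⟩ := hedge _ (hmem i₀)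
  obtain ⟨p₂, q₂, m₂, hp₂, hq₂, H₂⟩ := hedge _ (hmem i₁)
  obtain ⟨p₁, q₁, m₁, hp₁, hq₁, H₁⟩ := hedge _ (hmem i₂)
  have a1 := H₃ _ (hmem i₁) h01
  have a2 := H₂ _ (hmem i₂) h12
  have c0 : (0 : ℝ) ≤ e i₀ := Nat.cast_nonneg _
  exact h.not_staircase m₁ m₂ m₃ (by linarith) (by linarith) (by linarith)
    (a2.2 _ _ m₁ hp₁) (a1.2 _ _ m₂ hp₂)

/-- If the reach is bounded and only finitely many `newReach n (2 * n)` occur then edges which are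
longer than their distance to the origin start in a bounded set. -/
theorem exists_bound_of_eventually_not_newReach (h : StableConfig m)
    (hK : ∀ c : ℝ, ∃ K : ℝ, ∀ x y, (graph m).Adj x y → x ≤ c → y ≤ K)
    (hev : ∀ᶠ n : ℕ in atTop, m ∉ newReach n (2 * n)) :
    ∃ C : ℝ, ∀ x y, (x, y) ∈ pts m → 0 < x → 2 * x < y → x ≤ C := by
  obtain ⟨n₀, hn₀⟩ := eventually_atTop.1 hev
  obtain ⟨K, hK⟩ := hK n₀
  -- An edge starting in `(n, n + 1]` and reaching beyond `2 * n` lies below one starting earlier.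
  have hdesc : ∀ (s : ℤ) (n : ℕ), n₀ ≤ n → 2 * (n : ℤ) ≤ s + 2 → 0 < m (straddling n s) →
      0 < m (straddling n₀ s) := by
    intro s n hn
    induction n, hn using Nat.le_induction with
    | base => exact fun _ h => h
    | succ n hn ih =>
      intro hs hpos
      refine ih (by push_cast at hs; omega) (pos_iff_ne_zero.2 fun h0 => hn₀ n hn ?_)
      exact ⟨s, by push_cast at hs; omega, by exact_mod_cast hpos, h0⟩
  refine ⟨max (n₀ + 1) (K / 2 + 1), fun x y hxy hx hy => ?_⟩
  by_contra! hlt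
  obtain ⟨hlt1, hlt2⟩ := max_lt_iff.1 hlt
  set n := ⌊x⌋₊ with hn
  have hnx : (n : ℝ) ≤ x := Nat.floor_le hx.le
  have hxn : x < n + 1 := Nat.lt_floor_add_one x
  have hnn : n₀ ≤ n + 1 := by
    have : (n₀ : ℝ) < n + 1 := by linarith
    exact_mod_cast this.le
  have hpos : 0 < m (straddling ((n + 1 : ℕ) : ℤ) (2 * n)) := by
    refine lt_of_lt_of_le hxy (measure_mono (singleton_subset_iff.2 ⟨?_, ?_⟩))
    · simp only [mem_Iic]; push_cast; linarith
    · simp only [mem_Ioi]; push_cast; linarith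
  obtain ⟨⟨p, q⟩, ⟨hp, hq⟩, hpq⟩ := h.exists_mem_pts
    (hdesc (2 * n) (n + 1) hnn (by push_cast; omega) hpos)
  simp only [mem_Iic, mem_Ioi] at hp hq
  push_cast at hp hq
  have := hK p q ((graph_adj _ _ _).2 ⟨h.ne _ _ hpq, Or.inl hpq⟩) hp
  linarith

end StableConfig

/-- Along a stationary process of stable configurations, at most finitely many of the events
`newReach n (2 * n)` occur: by stationarity these have the probabilities of the events
`newReach (-n) 0`, of which at most two occur at a time. -/
theorem ae_eventually_not_newReach {Ω : Type*} [MeasurableSpace Ω] {P : Measure Ω}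
    [IsProbabilityMeasure P] {N : Ω → Measure (ℝ × ℝ)} (hN : Measurable N)
    (hinv : ∀ t : ℝ, P.map (fun ω => (N ω).map (fun p : ℝ × ℝ => (p.1 + t, p.2 + t))) = P.map N)
    (hst : ∀ᵐ ω ∂P, StableConfig (N ω)) :
    ∀ᵐ ω ∂P, ∀ᶠ n : ℕ in atTop, N ω ∉ newReach n (2 * n) := by
  have hprob : ∀ n : ℕ, P {ω | N ω ∈ newReach n (2 * n)} = P {ω | N ω ∈ newReach (-n) 0} := by
    intro n
    have hsh : Measurable (fun p : ℝ × ℝ => (p.1 + (2 * n : ℝ), p.2 + (2 * n : ℝ))) := by fun_prop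
    have h1 := congrArg (fun μ => μ (newReach n (2 * n))) (hinv (2 * n))
    beta_reduce at h1
    have hNs : Measurable fun ω =>
        (N ω).map (fun p : ℝ × ℝ => (p.1 + (2 * n : ℝ), p.2 + (2 * n : ℝ))) :=
      (Measure.measurable_map _ hsh).comp hN
    rw [Measure.map_apply hNs (measurableSet_newReach _ _),
      Measure.map_apply hN (measurableSet_newReach _ _)] at h1
    refine h1.symm.trans (congrArg P ?_)
    have hpre : ∀ a s : ℤ, (fun p : ℝ × ℝ => (p.1 + (2 * n : ℝ), p.2 + (2 * n : ℝ))) ⁻¹'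
        straddling a s = straddling (a - 2 * n) (s - 2 * n) := by
      intro a s
      ext ⟨x, y⟩
      simp [straddling, le_sub_iff_add_le, sub_lt_iff_lt_add]
    ext ω
    simp only [mem_preimage, newReach, mem_ofPred_eq,
      Measure.map_apply hsh (measurableSet_straddling _ _), hpre]
    constructor
    · rintro ⟨s, hs, h1, h2⟩
      refine ⟨s - 2 * n, by omega, ?_, ?_⟩
      · convert h1 using 3; ring
      · convert h2 using 3; ring
    · rintro ⟨s, hs, h1, h2⟩
      refine ⟨s + 2 * n, by omega, ?_, ?_⟩
      · convert h1 using 3 <;> ring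
      · convert h2 using 3 <;> ring
  have hsum : ∑' n : ℕ, P {ω | N ω ∈ newReach ((n + 1 : ℕ) : ℤ) (2 * ((n + 1 : ℕ) : ℤ))} ≠ ⊤ := by
    simp_rw [hprob]
    have hmeas : ∀ n : ℕ, MeasurableSet {ω | N ω ∈ newReach (-((n + 1 : ℕ) : ℤ)) 0} :=
      fun n => hN (measurableSet_newReach _ _)
    have hle : ∑' n : ℕ, P {ω | N ω ∈ newReach (-((n + 1 : ℕ) : ℤ)) 0} ≤ ∫⁻ _, 2 ∂P := by
      simp_rw [← lintegral_indicator_one (hmeas _)]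
      rw [← lintegral_tsum fun n => (measurable_one.indicator (hmeas n)).aemeasurable]
      refine lintegral_mono_ae ?_
      filter_upwards [hst] with ω hω
      rw [ENNReal.tsum_eq_iSup_sum]
      refine iSup_le fun F => ?_
      classical
      have hc := hω.card_le_two_of_newReach (F.filter fun n : ℕ => N ω ∈ newReach (-(n + 1)) 0)
        (fun n hn => (Finset.mem_filter.1 hn).2)
      have : ∑ n ∈ F, ({ω | N ω ∈ newReach (-((n + 1 : ℕ) : ℤ)) 0} : Set Ω).indicator
          (1 : Ω → ℝ≥0∞) ω = ((F.filter fun n : ℕ => N ω ∈ newReach (-(n + 1)) 0).card : ℝ≥0∞) := by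
        simp [Set.indicator_apply]
      rw [this]
      exact_mod_cast hc
    refine ne_top_of_le_ne_top ?_ hle
    simp
  filter_upwards [ae_eventually_notMem hsum] with ω hω
  obtain ⟨n₀, hn₀⟩ := eventually_atTop.1 hω
  refine eventually_atTop.2 ⟨n₀ + 1, fun n hn => ?_⟩
  obtain ⟨k, rfl⟩ : ∃ k, n = k + 1 := ⟨n - 1, by omega⟩
  exact hn₀ k (by omega)

/-! ### From matching schemes to stable configurations -/

theorem finite_pts_of_integerValued {m : Measure ℝ}
    (hm : ∀ A : Set ℝ, MeasurableSet A → Bornology.IsBounded A → ∃ n : ℕ, m A = n) (L : ℝ) :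
    {x | x ∈ pts m ∧ |x| ≤ L}.Finite := by
  by_contra hinf
  obtain ⟨n, hn⟩ := hm (Icc (-L) L) measurableSet_Icc (Metric.isBounded_Icc _ _)
  obtain ⟨t, ht, hcard⟩ := Set.Infinite.exists_subset_card_eq hinf (n + 1)
  have h1 : ∀ x ∈ t, (1 : ℝ≥0∞) ≤ m {x} := by
    intro x hx
    obtain ⟨k, hk⟩ := hm {x} (measurableSet_singleton x) Bornology.isBounded_singleton
    have : 0 < m {x} := (ht hx).1
    rw [hk] at this ⊢
    exact_mod_cast Nat.one_le_iff_ne_zero.2 (by rintro rfl; simp at this)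
  have h2 : (t.card : ℝ≥0∞) ≤ m t := by
    rw [← sum_measure_singleton, ← nsmul_one]
    exact Finset.card_nsmul_le_sum _ _ _ h1
  have h3 : m t ≤ n := hn ▸ measure_mono fun x hx => abs_le.1 (ht hx).2
  rw [hcard] at h2
  have : n + 1 ≤ n := by exact_mod_cast h2.trans h3
  omega

theorem edist_le_longest {m : Measure (ℝ × ℝ)} {x y : ℝ} (h : (graph m).Adj x y) :
    edist x y ≤ longest m x :=
  le_iSup₂ (f := fun z (_ : z ∈ (graph m).neighborSet x) => edist x z) y h

theorem edist_lt_edist_iff_abs (a b c d : ℝ) : edist a b < edist c d ↔ |a - b| < |c - d| := by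
  rw [edist_dist, edist_dist, ENNReal.ofReal_lt_ofReal_iff_of_nonneg dist_nonneg, Real.dist_eq,
    Real.dist_eq]

theorem desires_iff {m : Measure (ℝ × ℝ)} {x y : ℝ} :
    Desires m x y ↔ ∃ z, (graph m).Adj x z ∧ |x - y| < |x - z| := by
  simp only [Desires, longest, lt_iSup_iff, edist_lt_edist_iff_abs, SimpleGraph.mem_neighborSet,
    exists_prop]

theorem IsStableMultiMatching.ae_stableConfig {Ω : Type*} [MeasurableSpace Ω] {P : Measure Ω}
    {R B : Ω → Measure ℝ} {M : Ω → Measure (ℝ × ℝ)} (hM : IsStableMultiMatching P R B 2 2 M)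
    (hR : IsPointProcess P R) (hB : IsPointProcess P B) : ∀ᵐ ω ∂P, StableConfig (M ω) := by
  filter_upwards [hM.integerValued, hM.bipartite, hM.simple, hM.degree_red, hM.degree_blue,
    hM.stable, hR.integerValued, hB.integerValued] with ω hint hbip hsim hdR hdB hst hRi hBi
  have hcol : ∀ x y, (graph (M ω)).Adj x y → x ∈ pts (R ω) ∨ x ∈ pts (B ω) := by
    intro x y hxy
    rcases ((graph_adj _ _ _).1 hxy).2 with h | h
    · exact Or.inl (hbip _ h).1
    · exact Or.inr (hbip _ h).2
  refine ⟨hint, fun x y h => (hsim _ h).2, fun x y hxy => ?_, fun L => ?_, ?_⟩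
  · rcases hcol x y hxy with h | h
    · exact hdR x h
    · exact hdB x h
  · refine ((finite_pts_of_integerValued hRi L).union (finite_pts_of_integerValued hBi L)).subset ?_
    rintro x ⟨⟨y, hy⟩, hx⟩
    exact (hcol x y hy).imp (fun h => ⟨h, hx⟩) fun h => ⟨h, hx⟩
  · intro r b r' b' h1 h2 hne h3 h4
    have a1 : (graph (M ω)).Adj r b' := (graph_adj _ _ _).2 ⟨(hsim _ h1).2, Or.inl h1⟩
    have a2 : (graph (M ω)).Adj b r' := (graph_adj _ _ _).2 ⟨(hsim _ h2).2.symm, Or.inr h2⟩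
    rcases hst r (hbip _ h1).1 b (hbip _ h2).2 hne with h | h | h
    · exact h
    · exact absurd ((edist_le_longest a1).trans h)
        (not_le.2 ((edist_lt_edist_iff_abs _ _ _ _).2 h3))
    · refine absurd ((edist_le_longest a2).trans h)
        (not_le.2 ((edist_lt_edist_iff_abs _ _ _ _).2 ?_))
      rwa [abs_sub_comm b r']

/-- Stationarity passes to images under maps that intertwine the translations, such as the
reflection and the exchange of colors. -/
theorem map_stationary {Ω : Type*} [MeasurableSpace Ω] {P : Measure Ω}
    {M : Ω → Measure (ℝ × ℝ)} (hM : Measurable M)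
    (hinv : ∀ t : ℝ, P.map (fun ω => (M ω).map (fun p : ℝ × ℝ => (p.1 + t, p.2 + t))) = P.map M)
    (e : ℝ × ℝ ≃ᵐ ℝ × ℝ)
    (he : ∀ t : ℝ, ∃ t' : ℝ, ∀ p, ((e p).1 + t, (e p).2 + t) = e (p.1 + t', p.2 + t')) (t : ℝ) :
    P.map (fun ω => ((M ω).map e).map (fun p : ℝ × ℝ => (p.1 + t, p.2 + t))) =
      P.map (fun ω => (M ω).map e) := by
  obtain ⟨t', ht'⟩ := he t
  have hs : ∀ t : ℝ, Measurable (fun p : ℝ × ℝ => (p.1 + t, p.2 + t)) := fun t => by fun_prop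
  have h1 : (fun ω => ((M ω).map e).map (fun p : ℝ × ℝ => (p.1 + t, p.2 + t))) =
      (Measure.map e) ∘ fun ω => (M ω).map (fun p : ℝ × ℝ => (p.1 + t', p.2 + t')) := by
    funext ω
    simp only [Function.comp_apply]
    rw [Measure.map_map (hs t) e.measurable, Measure.map_map e.measurable (hs t')]
    congr 1
    funext p
    exact ht' p
  have h2 : (fun ω => (M ω).map e) = (Measure.map e) ∘ M := rfl
  have hMs : Measurable fun ω => (M ω).map (fun p : ℝ × ℝ => (p.1 + t', p.2 + t')) :=
    (Measure.measurable_map _ (hs t')).comp hM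
  rw [h1, h2, ← Measure.map_map (Measure.measurable_map _ e.measurable) hMs, hinv t',
    Measure.map_map (Measure.measurable_map _ e.measurable) hM]

/-! ### Finitely many points desire the origin -/

/-- The points of `(0, ∞)` desiring the origin are bounded. The events for `m` and for its color
exchange serve the two possible colors of the desiring point. -/
theorem StableConfig.exists_bound_desires {m : Measure (ℝ × ℝ)} (h : StableConfig m) {L : ℝ}
    (hL : ∀ x y, (graph m).Adj x y → x < -L → y ≤ L)
    (hev : ∀ᶠ n : ℕ in atTop, m ∉ newReach n (2 * n))
    (hev' : ∀ᶠ n : ℕ in atTop, m.map swapEdge ∉ newReach n (2 * n)) :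
    ∃ C : ℝ, ∀ x, 0 < x → Desires m x 0 → x ≤ C := by
  have hK := h.exists_reach_bound hL
  obtain ⟨C, hC⟩ := h.exists_bound_of_eventually_not_newReach hK hev
  obtain ⟨C', hC'⟩ := h.map_swapEdge.exists_bound_of_eventually_not_newReach
    (by simpa only [graph_map_swapEdge] using hK) hev'
  obtain ⟨K, hK⟩ := hK 0
  refine ⟨max K (max C C'), fun x hx hd => ?_⟩
  obtain ⟨y, hxy, hlt⟩ := desires_iff.1 hd
  rw [sub_zero, abs_of_pos hx, lt_abs] at hlt
  rcases hlt with hlt | hlt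
  · exact (hK y x hxy.symm (by linarith)).trans (le_max_left _ _)
  · rcases ((graph_adj _ _ _).1 hxy).2 with hp | hp
    · have := hC x y hp hx (by linarith)
      simp [this]
    · have := hC' x y ((mem_pts_map_swapEdge _ _ _).2 hp) hx (by linarith)
      simp [this]

theorem IsStableMultiMatching.ae_numDesireOrigin_lt_top {Ω : Type*} [MeasurableSpace Ω]
    {P : Measure Ω} [IsProbabilityMeasure P] {R B : Ω → Measure ℝ} {M : Ω → Measure (ℝ × ℝ)}
    (hM : IsStableMultiMatching P R B 2 2 M) (hR : IsPointProcess P R) (hB : IsPointProcess P B)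
    (hinf : ∀ᵐ ω ∂P, HasInfiniteComponent (M ω)) :
    ∀ᵐ ω ∂P, numDesireOrigin (B ω) (M ω) < ⊤ := by
  have hst := hM.ae_stableConfig hR hB
  have hmap : ∀ e : ℝ × ℝ ≃ᵐ ℝ × ℝ, Measurable (Measure.map e : Measure (ℝ × ℝ) → _) :=
    fun e => Measure.measurable_map _ e.measurable
  have hinvN := map_stationary hM.measurable hM.invariant negEdge fun t =>
    ⟨-t, fun p => by
      change (-p.1 + t, -p.2 + t) = (-(p.1 + -t), -(p.2 + -t))
      simp only [Prod.mk.injEq]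
      constructor <;> ring⟩
  have hmN : Measurable fun ω => (M ω).map negEdge := (hmap _).comp hM.measurable
  have hswap : ∀ t : ℝ, ∃ t' : ℝ, ∀ p : ℝ × ℝ,
      ((swapEdge p).1 + t, (swapEdge p).2 + t) = swapEdge (p.1 + t', p.2 + t') :=
    fun t => ⟨t, fun _ => rfl⟩
  filter_upwards [hst, hinf, ae_eventually_not_newReach hM.measurable hM.invariant hst,
    ae_eventually_not_newReach ((hmap swapEdge).comp hM.measurable)
      (map_stationary hM.measurable hM.invariant swapEdge hswap)
      (hst.mono fun _ h => h.map_swapEdge),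
    ae_eventually_not_newReach hmN hinvN (hst.mono fun _ h => h.map_negEdge),
    ae_eventually_not_newReach ((hmap swapEdge).comp hmN)
      (map_stationary hmN hinvN swapEdge hswap)
      (hst.mono fun _ h => h.map_negEdge.map_swapEdge)] with ω h hi e1 e2 e3 e4
  obtain ⟨L, hL⟩ := h.exists_not_straddled hi
  obtain ⟨C, hC⟩ := h.exists_bound_desires hL e1 e2
  have hL' : ∀ x y, (graph ((M ω).map negEdge)).Adj x y → x < -L → y ≤ L := by
    intro x y hxy hx
    by_contra! hy
    have := hL (-y) (-x) ((graph_map_negEdge_adj _ _ _).1 hxy).symm (by linarith)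
    linarith
  obtain ⟨C', hC'⟩ := h.map_negEdge.exists_bound_desires hL' e3 e4
  refine Set.encard_lt_top_iff.2 ((h.locallyFinite (max 0 (max C C'))).subset ?_)
  rintro x ⟨-, hd⟩
  obtain ⟨y, hxy, hlt⟩ := desires_iff.1 hd
  refine ⟨⟨y, hxy⟩, ?_⟩
  rcases lt_trichotomy x 0 with hx | rfl | hx
  · have := hC' (-x) (by linarith) (desires_iff.2 ⟨-y, by simpa using hxy, ?_⟩)
    · rw [abs_of_neg hx]; simp [this]
    · rw [← abs_neg (-x - 0), ← abs_neg (-x - -y)]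
      convert hlt using 2 <;> ring
  · simp
  · have := hC x hx hd
    rw [abs_of_pos hx]; simp [this]

end TwoColor

theorem proposition3p1 {Ω : Type*} [MeasurableSpace Ω] (P : Measure Ω) [IsProbabilityMeasure P]
    (lam : ℝ≥0) (R B : Ω → Measure ℝ)
    (hR : TwoColor.IsPoissonProcess P R lam) (hB : TwoColor.IsPoissonProcess P B lam)
    (hRB : IndepFun R B P)
    (M : Ω → Measure (ℝ × ℝ)) (hM : TwoColor.IsStableMultiMatching P R B 2 2 M)
    (hinf : ∀ᵐ ω ∂P, TwoColor.HasInfiniteComponent (M ω)) :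
    ∀ᵐ ω ∂P, TwoColor.numDesireOrigin (B ω) (M ω) < ⊤ := 
  hM.ae_numDesireOrigin_lt_top hR.toIsPointProcess hB.toIsPointProcess hinf
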